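/- An $n$-bit Boolean function is a map $f:\{0,1\}^n\to\{0,1\}$. Two $n$-bit Boolean functions are called isomorphic if they are equal up to permutation and negations of the input variables and negation of the output. $\mathrm{AND}_n$ is the function with $\mathrm{AND}_n(x)=1$ iff $x_1=\dots=x_n=1$. A quantum query algorithm with $t$ queries works in a finite-dimensional Hilbert space $\mathbb{C}^B$ with a fixed standard basis, each of whose basis states corresponds to one input bit or to none. It starts in a fixed unit vector and applies in turn $U_1,Q,U_2,Q,\dots,U_t,Q,U_{t+1}$, where the $U_j$ are unitary and do not depend on the input $x$, and where the query transformation $Q$ multiplies a basis state by $(-1)^{x_i}$ if it corresponds to the $i$-th input bit and leaves it unchanged if it corresponds to none. The final state is measured in the standard basis, and the output, $0$ or $1$, is a function of the result. The algorithm computes $f$ exactly if, on every input $x$, the output is $f(x)$ with probability $1$. The exact quantum query complexity $Q_E(f)$ is the minimum number $t$ of queries of an algorithm that computes $f$ exactly. Theorem. Let $f:\{0,1\}^4\to\{0,1\}$ be a $4$-bit Boolean function. Then $Q_E(f)=4$ if and only if $f$ is isomorphic to $\mathrm{AND}_4$. -/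

import Mathlib

open scoped Matrix

/-- `n`-bit (total) Boolean functions, with `true` as `1` and `false` as `0`. -/
abbrev BoolFun (n : ℕ) : Type := (Fin n → Bool) → Bool

/-- `AND_n(x) = 1` iff all input bits are `1`. -/
def andFun (n : ℕ) : BoolFun n := fun x => decide (∀ i, x i = true)

/-- Two Boolean functions are (query-)isomorphic if they are equal up to negations and
permutations of the input variables and negation of the output. -/
def QueryIsomorphic {n : ℕ} (f g : BoolFun n) : Prop :=
  ∃ (σ : Equiv.Perm (Fin n)) (a : Fin n → Bool) (c : Bool),
    ∀ x : Fin n → Bool, f x = xor c (g fun i => xor (a i) (x (σ i)))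

/-- A quantum query algorithm with `t` queries on `n` input bits, acting on the Hilbert space
`ℂ^B` with standard basis indexed by the nonempty finite type `B`. -/
structure QueryAlgorithm (n t : ℕ) where
  /-- labels of the standard basis states -/
  B : Type
  [fintypeB : Fintype B]
  [decEqB : DecidableEq B]
  /-- the fixed starting state -/
  init : B → ℂ
  /-- the starting state is a unit vector -/
  init_unit : ∑ b, ‖init b‖ ^ 2 = 1
  /-- `unit 0, …, unit t` are the `t + 1` input-independent unitary transformations -/
  unit : Fin (t + 1) → Matrix.unitaryGroup B ℂ
  /-- the input bit, if any, to which a basis state corresponds -/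
  label : B → Option (Fin n)
  /-- the value announced for each result of the final measurement -/
  out : B → Bool

namespace QueryAlgorithm

attribute [instance] QueryAlgorithm.fintypeB QueryAlgorithm.decEqB

variable {n t : ℕ} (A : QueryAlgorithm n t)

/-- The eigenvalue of the query transformation on the basis state `b`: it is `(-1)^{x_i}` if `b`
corresponds to the `i`-th input bit and `1` if `b` corresponds to no input bit. -/
def phase (x : Fin n → Bool) (b : A.B) : ℂ :=
  match A.label b with
  | none => 1
  | some i => if x i then -1 else 1

/-- The query transformation on input `x`, diagonal in the standard basis. -/
def query (x : Fin n → Bool) : Matrix A.B A.B ℂ := Matrix.diagonal (A.phase x)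

/-- The state on input `x` after `U₁, Q, U₂, …, Q, U_{k+1}`, that is, after `k` queries. -/
def state (x : Fin n → Bool) : (k : ℕ) → k < t + 1 → A.B → ℂ
  | 0, h => (A.unit ⟨0, h⟩ : Matrix A.B A.B ℂ) *ᵥ A.init
  | k + 1, h => (A.unit ⟨k + 1, h⟩ : Matrix A.B A.B ℂ) *ᵥ
      (A.query x *ᵥ state x k (Nat.lt_of_succ_lt h))

/-- The state on input `x` just before the measurement. -/
def finalState (x : Fin n → Bool) : A.B → ℂ := A.state x t (Nat.lt_succ_self t)

/-- The probability of output `v` on input `x`, when the final state is measured in the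
standard basis. -/
noncomputable def outputProb (x : Fin n → Bool) (v : Bool) : ℝ :=
  ∑ b, if A.out b = v then ‖A.finalState x b‖ ^ 2 else 0

/-- The algorithm computes `f` exactly: on every input it outputs `f x` with certainty. -/
def ComputesExactly (f : BoolFun n) : Prop := ∀ x, A.outputProb x (f x) = 1

end QueryAlgorithm

/-- The exact quantum query complexity `Q_E(f)`: the minimum number of queries used by a quantum
query algorithm that computes `f` exactly (`⊤` would mean that there is no such algorithm). -/
noncomputable def exactQuantumQueryComplexity {n : ℕ} (f : BoolFun n) : ℕ∞ :=
  ⨅ (t : ℕ) (_ : ∃ A : QueryAlgorithm n t, A.ComputesExactly f), (t : ℕ∞)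

/-! The lower bound is the polynomial method. After `k` queries every amplitude, as a function of
the input, is a combination of parities of at most `k` bits, so with fewer than `n` queries it is
orthogonal to the parity of all `n` bits. If `f` takes its value at `p` nowhere else, the amplitudes
of results announcing that value vanish off `p`, hence by orthogonality also at `p`; then the whole
final state at `p` is zero, which is absurd (`QueryAlgorithm.ComputesExactly.le_of_unique`). The
functions isomorphic to AND are those taking one of their values exactly once.

For the upper bound, an algorithm matters only through the Gram matrix of its states over all
inputs: families with equal Gram matrices differ by a unitary (`exists_unitary_mul_eq_of_gram_eq`).
This turns the existence of an algorithm into the semidefinite recursion `QuerySolvable`. A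
`QueryTree` is a combinatorial certificate for it: query a superposition, measure, discard the
inputs on which the outcome has amplitude zero, and continue adaptively (`QueryTree.querySolvable`).

It remains to find trees. A finite check gives a two-query tree for every three-bit function without
a unique value (`exists_firstMasks_all_parityOnMask`). For four bits, one query reveals a bit or the
parity of two bits and leaves a three-bit function; a second finite check (`splittable_of_lt`) shows
that, unless `f` itself has a unique value, some choice leaves a function without a unique value in
both cases. -/

/-! ### Gram matrices and unitary equivalence. -/

section Unitary

variable {B X : Type*} [Fintype B] [Fintype X]

theorem norm_toLp_mulVec_eq_of_gram_eq {Φ Ψ : Matrix B X ℂ} (h : Φᴴ * Φ = Ψᴴ * Ψ) (c : X → ℂ) :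
    ‖WithLp.toLp 2 (Φ *ᵥ c)‖ = ‖WithLp.toLp 2 (Ψ *ᵥ c)‖ := by
  have key : ∀ M : Matrix B X ℂ, ((‖WithLp.toLp 2 (M *ᵥ c)‖ : ℂ)) ^ 2 =
      star c ⬝ᵥ ((Mᴴ * M) *ᵥ c) := by
    intro M
    have := inner_self_eq_norm_sq_to_K (𝕜 := ℂ) (WithLp.toLp 2 (M *ᵥ c))
    rw [EuclideanSpace.inner_toLp_toLp, dotProduct_comm, Matrix.star_mulVec,
      ← Matrix.dotProduct_mulVec, Matrix.mulVec_mulVec] at this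
    exact this.symm
  have h2 : ((‖WithLp.toLp 2 (Φ *ᵥ c)‖ : ℂ)) ^ 2 = (‖WithLp.toLp 2 (Ψ *ᵥ c)‖ : ℂ) ^ 2 := by
    rw [key, key, h]
  have h3 : ‖WithLp.toLp 2 (Φ *ᵥ c)‖ ^ 2 = ‖WithLp.toLp 2 (Ψ *ᵥ c)‖ ^ 2 := by exact_mod_cast h2
  exact (sq_eq_sq₀ (norm_nonneg _) (norm_nonneg _)).1 h3

/-- Two families of vectors with the same Gram matrix differ by a unitary transformation. -/
theorem exists_unitary_mul_eq_of_gram_eq [DecidableEq B] [DecidableEq X] {Φ Ψ : Matrix B X ℂ}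
    (h : Φᴴ * Φ = Ψᴴ * Ψ) :
    ∃ U : Matrix.unitaryGroup B ℂ, (U : Matrix B B ℂ) * Φ = Ψ := by
  let T : Matrix B X ℂ → (X → ℂ) →ₗ[ℂ] EuclideanSpace ℂ B := fun M =>
    (WithLp.linearEquiv 2 ℂ (B → ℂ)).symm.toLinearMap ∘ₗ M.mulVecLin
  have hT : ∀ M c, T M c = WithLp.toLp 2 (M *ᵥ c) := fun M c => rfl
  have hnorm : ∀ c, ‖T Φ c‖ = ‖T Ψ c‖ := norm_toLp_mulVec_eq_of_gram_eq h
  -- The isometry sends `T Φ c` to `T Ψ c` on the range of `T Φ`; a linear section `r` defines it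
  -- without choosing representatives by hand.
  obtain ⟨r, hr⟩ := (T Φ).rangeRestrict.exists_rightInverse_of_surjective
    (LinearMap.range_rangeRestrict _)
  have hr' : ∀ w : LinearMap.range (T Φ), T Φ (r w) = w := fun w =>
    congrArg Subtype.val (LinearMap.congr_fun hr w)
  let S : LinearMap.range (T Φ) →ₗᵢ[ℂ] EuclideanSpace ℂ B :=
    ⟨T Ψ ∘ₗ r, fun w => by
      rw [LinearMap.comp_apply, ← hnorm, hr']; rfl⟩
  have hS : ∀ c, S.extend (T Φ c) = T Ψ c := by
    intro c
    have h1 := S.extend_apply ⟨T Φ c, LinearMap.mem_range_self _ c⟩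
    refine h1.trans ?_
    change T Ψ (r _) = T Ψ c
    -- Equal norms give equal kernels, so the choice of preimage does not matter.
    rw [← sub_eq_zero, ← map_sub, ← norm_eq_zero, ← hnorm, map_sub, hr', sub_self, norm_zero]
  let e : EuclideanSpace ℂ B ≃ₗᵢ[ℂ] EuclideanSpace ℂ B :=
    S.extend.toLinearIsometryEquiv rfl
  let b := EuclideanSpace.basisFun B ℂ
  refine ⟨⟨_, e.toMatrix_mem_unitaryGroup b b⟩, ?_⟩
  have hU : ∀ v : EuclideanSpace ℂ B, (LinearMap.toMatrix b.toBasis b.toBasis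
      (e.toLinearEquiv : _ →ₗ[ℂ] _)) *ᵥ v.ofLp = (e v).ofLp := by
    intro v
    have := LinearMap.toMatrix_mulVec_repr b.toBasis b.toBasis
      (e.toLinearEquiv : _ →ₗ[ℂ] _) v
    have hrepr : ∀ w : EuclideanSpace ℂ B, ⇑(b.toBasis.repr w) = w.ofLp := by
      intro w; ext i; simp [b, OrthonormalBasis.coe_toBasis_repr_apply]
    rw [hrepr, LinearEquiv.coe_coe, hrepr] at this
    exact this
  ext i x
  have h2 := congrFun (hU (T Φ (Pi.single x 1))) i
  have h3 : e (T Φ (Pi.single x 1)) = T Ψ (Pi.single x 1) := hS _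
  rw [h3] at h2
  simpa [hT, Matrix.mul_apply, Matrix.mulVec, dotProduct] using h2

open scoped MatrixOrder ComplexOrder in
theorem Matrix.PosSemidef.exists_conjTranspose_mul_self_eq [DecidableEq X] {M : Matrix X X ℂ}
    (hM : M.PosSemidef) : ∃ A : Matrix X X ℂ, M = Aᴴ * A :=
  CStarAlgebra.nonneg_iff_eq_star_mul_self.mp hM.nonneg

end Unitary

/-! ### Signs introduced by a query. -/

section Sign

variable {n : ℕ}

/-- The sign `(-1)^{x_i}` of an input bit, or `1` for the label of no input bit. -/
def literalSign (x : Fin n → Bool) : Option (Fin n) → ℤ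
  | none => 1
  | some i => if x i then -1 else 1

theorem literalSign_eq (x : Fin n → Bool) (i : Option (Fin n)) :
    literalSign x i = 1 ∨ literalSign x i = -1 := by
  cases i with
  | none => exact Or.inl rfl
  | some i => cases h : x i <;> simp [literalSign, h]

theorem literalSign_mul_self (x : Fin n → Bool) (i : Option (Fin n)) :
    literalSign x i * literalSign x i = 1 := by
  rcases literalSign_eq x i with h | h <;> simp [h]

theorem QueryAlgorithm.phase_eq {t : ℕ} (A : QueryAlgorithm n t) (x : Fin n → Bool) (b : A.B) :
    A.phase x b = literalSign x (A.label b) := by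
  unfold QueryAlgorithm.phase literalSign
  cases A.label b with
  | none => simp
  | some i => cases h : x i <;> simp [h]

theorem QueryAlgorithm.state_succ_apply {t : ℕ} (A : QueryAlgorithm n t) (x : Fin n → Bool)
    (k : ℕ) (h : k + 1 < t + 1) (b : A.B) :
    A.state x (k + 1) h b = ∑ c, (A.unit ⟨k + 1, h⟩ : Matrix A.B A.B ℂ) b c *
      (literalSign x (A.label c) * A.state x k (Nat.lt_of_succ_lt h) c) := by
  simp only [QueryAlgorithm.state, Matrix.mulVec, dotProduct, QueryAlgorithm.query,
    Matrix.diagonal_apply, ite_mul, zero_mul, Finset.sum_ite_eq, Finset.mem_univ, if_true,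
    QueryAlgorithm.phase_eq]

end Sign

/-! ### Conservation of norm and certainty of the output. -/

section Norm

theorem sum_norm_sq_eq_star_dotProduct {B : Type*} [Fintype B] (v : B → ℂ) :
    ((∑ b, ‖v b‖ ^ 2 : ℝ) : ℂ) = star v ⬝ᵥ v := by
  simp only [dotProduct, Pi.star_apply, Complex.ofReal_sum, Complex.ofReal_pow]
  exact Finset.sum_congr rfl fun b _ => by
    rw [← Complex.conj_mul']; rfl

theorem sum_norm_sq_unitary_mulVec {B : Type*} [Fintype B] [DecidableEq B]
    (U : Matrix.unitaryGroup B ℂ) (v : B → ℂ) :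
    ∑ b, ‖((U : Matrix B B ℂ) *ᵥ v) b‖ ^ 2 = ∑ b, ‖v b‖ ^ 2 := by
  have h : ((∑ b, ‖((U : Matrix B B ℂ) *ᵥ v) b‖ ^ 2 : ℝ) : ℂ) = (∑ b, ‖v b‖ ^ 2 : ℝ) := by
    rw [sum_norm_sq_eq_star_dotProduct, sum_norm_sq_eq_star_dotProduct, Matrix.star_mulVec,
      ← Matrix.dotProduct_mulVec, Matrix.mulVec_mulVec]
    have := Matrix.UnitaryGroup.star_mul_self U
    rw [Matrix.star_eq_conjTranspose] at this
    rw [this, Matrix.one_mulVec]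
  exact_mod_cast h

variable {n t : ℕ} (A : QueryAlgorithm n t)

theorem QueryAlgorithm.sum_norm_sq_state (x : Fin n → Bool) (k : ℕ) (h : k < t + 1) :
    ∑ b, ‖A.state x k h b‖ ^ 2 = 1 := by
  induction k with
  | zero => exact (sum_norm_sq_unitary_mulVec _ _).trans A.init_unit
  | succ k ih =>
    refine (sum_norm_sq_unitary_mulVec _ _).trans ?_
    rw [← ih (Nat.lt_of_succ_lt h)]
    refine Finset.sum_congr rfl fun b _ => ?_
    rw [QueryAlgorithm.query, Matrix.mulVec_diagonal, norm_mul, A.phase_eq]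
    rcases literalSign_eq x (A.label b) with h | h <;> simp [h]

theorem QueryAlgorithm.outputProb_eq_one_iff (x : Fin n → Bool) (v : Bool) :
    A.outputProb x v = 1 ↔ ∀ b, A.out b ≠ v → A.finalState x b = 0 := by
  have h1 := A.sum_norm_sq_state x t (Nat.lt_succ_self t)
  have h2 : A.outputProb x v + ∑ b, (if A.out b ≠ v then ‖A.finalState x b‖ ^ 2 else 0) = 1 := by
    rw [← h1, QueryAlgorithm.outputProb, ← Finset.sum_add_distrib]
    refine Finset.sum_congr rfl fun b _ => ?_
    by_cases h : A.out b = v <;> simp [h, QueryAlgorithm.finalState]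
  have h3 : A.outputProb x v = 1 ↔
      ∑ b, (if A.out b ≠ v then ‖A.finalState x b‖ ^ 2 else 0) = 0 := by
    constructor <;> intro h <;> linarith
  rw [h3, Finset.sum_eq_zero_iff_of_nonneg (fun b _ => by split_ifs <;> positivity)]
  refine forall_congr' fun b => ?_
  by_cases h : A.out b = v <;> simp [h]

end Norm

/-! ### From Gram matrices to algorithms. -/

section Solvable

variable {n : ℕ}

open scoped ComplexOrder in
/-- If the states on the various inputs have Gram matrix `G`, then `t` more queries suffice to
determine the value of `f`. -/
def QuerySolvable (f : BoolFun n) :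
    ℕ → Matrix (Fin n → Bool) (Fin n → Bool) ℂ → Prop
  | 0, G => G.PosSemidef ∧ ∀ x y, f x ≠ f y → G x y = 0
  | t + 1, G => ∃ M : Option (Fin n) → Matrix (Fin n → Bool) (Fin n → Bool) ℂ,
      (∀ i, (M i).PosSemidef) ∧ ∑ i, M i = G ∧
      QuerySolvable f t (∑ i, Matrix.of fun x y => (literalSign x i * literalSign y i : ℂ) * M i x y)

open scoped ComplexOrder in
theorem QuerySolvable.zero (f : BoolFun n) (t : ℕ) : QuerySolvable f t 0 := by
  induction t with
  | zero => exact ⟨Matrix.PosSemidef.zero, fun _ _ _ => rfl⟩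
  | succ t ih =>
    refine ⟨fun _ => 0, fun _ => Matrix.PosSemidef.zero, by simp, ?_⟩
    convert ih
    ext x y
    simp [Matrix.sum_apply]

open scoped ComplexOrder in
-- Two strategies can run side by side on orthogonal sectors of the space, where Gram matrices add.
-- This is what lets later queries depend on an earlier outcome.
theorem QuerySolvable.add {f : BoolFun n} {t : ℕ} {G H : Matrix (Fin n → Bool) (Fin n → Bool) ℂ}
    (hG : QuerySolvable f t G) (hH : QuerySolvable f t H) : QuerySolvable f t (G + H) := by
  induction t generalizing G H with
  | zero => exact ⟨hG.1.add hH.1, fun x y h => by simp [hG.2 x y h, hH.2 x y h]⟩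
  | succ t ih =>
    obtain ⟨M, hM, rfl, hM'⟩ := hG
    obtain ⟨N, hN, rfl, hN'⟩ := hH
    refine ⟨M + N, fun i => (hM i).add (hN i), by simp [Finset.sum_add_distrib], ?_⟩
    convert ih hM' hN'
    rw [← Finset.sum_add_distrib]
    refine Finset.sum_congr rfl fun i _ => ?_
    ext x y
    simp [mul_add]

theorem QuerySolvable.sum {f : BoolFun n} {t : ℕ} {ι : Type*} (s : Finset ι)
    {G : ι → Matrix (Fin n → Bool) (Fin n → Bool) ℂ}
    (hG : ∀ k ∈ s, QuerySolvable f t (G k)) : QuerySolvable f t (∑ k ∈ s, G k) := by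
  classical
  induction s using Finset.induction_on with
  | empty => simpa using QuerySolvable.zero f t
  | insert k s hk ih =>
    rw [Finset.sum_insert hk]
    exact (hG k (Finset.mem_insert_self k s)).add
      (ih fun j hj => hG j (Finset.mem_insert_of_mem hj))

/-- Standard basis of the universal work space: a work register, the label of the queried bit, and
the announced value. -/
abbrev WorkBasis (n : ℕ) : Type := (Fin n → Bool) × Option (Fin n) × Bool

/-- The query transformation applied to a family of states indexed by the inputs. -/
def queryFamily (Φ : Matrix (WorkBasis n) (Fin n → Bool) ℂ) :
    Matrix (WorkBasis n) (Fin n → Bool) ℂ :=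
  Matrix.of fun b x => (literalSign x b.2.1 : ℂ) * Φ b x

/-- The family of states after `k` queries interleaved with the unitaries `U`. -/
def evolveFamily (U : ℕ → Matrix.unitaryGroup (WorkBasis n) ℂ)
    (Φ : Matrix (WorkBasis n) (Fin n → Bool) ℂ) : ℕ → Matrix (WorkBasis n) (Fin n → Bool) ℂ
  | 0 => (U 0 : Matrix (WorkBasis n) (WorkBasis n) ℂ) * Φ
  | k + 1 => (U (k + 1) : Matrix (WorkBasis n) (WorkBasis n) ℂ) *
      queryFamily (evolveFamily U Φ k)

theorem evolveFamily_succ_eq (U : ℕ → Matrix.unitaryGroup (WorkBasis n) ℂ)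
    (Φ : Matrix (WorkBasis n) (Fin n → Bool) ℂ) (k : ℕ) :
    evolveFamily U Φ (k + 1) = evolveFamily (fun j => U (j + 1))
      (queryFamily ((U 0 : Matrix (WorkBasis n) (WorkBasis n) ℂ) * Φ)) k := by
  induction k with
  | zero => rfl
  | succ k ih => rw [evolveFamily, ih, evolveFamily]

/-- Each positive semidefinite part factors as `Aᴴ * A` with `2 ^ n` rows, so the work register has
room for it. A unitary moves the current states to this standard form, with the part `M i` placed at
label `i`, where the next query gives it the right sign. -/
theorem QuerySolvable.exists_unitaries {f : BoolFun n} {t : ℕ}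
    {G : Matrix (Fin n → Bool) (Fin n → Bool) ℂ} (hG : QuerySolvable f t G)
    (Φ : Matrix (WorkBasis n) (Fin n → Bool) ℂ) (hΦ : Φᴴ * Φ = G) :
    ∃ U : ℕ → Matrix.unitaryGroup (WorkBasis n) ℂ,
      ∀ b x, b.2.2 ≠ f x → evolveFamily U Φ t b x = 0 := by
  induction t generalizing G Φ with
  | zero =>
    obtain ⟨hpos, horth⟩ := hG
    obtain ⟨A, rfl⟩ := hpos.exists_conjTranspose_mul_self_eq
    -- Writing `f x` into the output register leaves the Gram matrix unchanged, because its entries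
    -- between inputs with different values are already zero.
    let Ψ : Matrix (WorkBasis n) (Fin n → Bool) ℂ :=
      Matrix.of fun b x => if b.2.1 = none ∧ b.2.2 = f x then A b.1 x else 0
    have hΨ : Φᴴ * Φ = Ψᴴ * Ψ := by
      rw [hΦ]
      ext x y
      by_cases hxy : f x = f y
      · simp [Ψ, Matrix.mul_apply, Fintype.sum_prod_type, ite_and, hxy]
      · rw [horth x y hxy]
        simp [Ψ, Matrix.mul_apply, Fintype.sum_prod_type, ite_and,
          Ne.symm hxy]
    obtain ⟨U, hU⟩ := exists_unitary_mul_eq_of_gram_eq hΨ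
    refine ⟨fun _ => U, fun b x hb => ?_⟩
    rw [evolveFamily, hU]
    simp [Ψ, hb]
  | succ t ih =>
    obtain ⟨M, hM, rfl, hnext⟩ := hG
    choose A hA using fun i => (hM i).exists_conjTranspose_mul_self_eq
    let Ψ : Matrix (WorkBasis n) (Fin n → Bool) ℂ :=
      Matrix.of fun b x => if b.2.2 = false then A b.2.1 b.1 x else 0
    have hΨ : Φᴴ * Φ = Ψᴴ * Ψ := by
      rw [hΦ]
      ext x y
      simp only [Matrix.sum_apply, hA, Ψ, Matrix.mul_apply, Fintype.sum_prod_type,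
        Matrix.conjTranspose_apply, Matrix.of_apply, Fintype.sum_bool]
      rw [Finset.sum_comm]
      simp
    obtain ⟨U, hU⟩ := exists_unitary_mul_eq_of_gram_eq hΨ
    obtain ⟨V, hV⟩ := ih hnext (queryFamily Ψ) (by
      ext x y
      simp only [Matrix.sum_apply, hA, Ψ, Matrix.mul_apply, Fintype.sum_prod_type,
        Matrix.conjTranspose_apply, Matrix.of_apply, Fintype.sum_bool, queryFamily]
      rw [Finset.sum_comm]
      simp only [Finset.mul_sum]
      refine Finset.sum_congr rfl fun i _ => Finset.sum_congr rfl fun z _ => ?_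
      simp
      ring)
    refine ⟨fun k => k.casesOn U V, fun b x hb => ?_⟩
    rw [evolveFamily_succ_eq]
    change evolveFamily V (queryFamily ((U : Matrix (WorkBasis n) (WorkBasis n) ℂ) * Φ)) t b x = 0
    rw [hU]
    exact hV b x hb

/-- The algorithm on the universal work space with given unitaries. -/
def workAlgorithm (t : ℕ) (U : ℕ → Matrix.unitaryGroup (WorkBasis n) ℂ) : QueryAlgorithm n t where
  B := WorkBasis n
  init := Pi.single default 1
  init_unit := by
    rw [Finset.sum_eq_single default (fun b _ hb => by simp [hb]) (by simp)]
    simp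
  unit := fun k => U k
  label := fun b => b.2.1
  out := fun b => b.2.2

theorem workAlgorithm_state (t : ℕ) (U : ℕ → Matrix.unitaryGroup (WorkBasis n) ℂ)
    (x : Fin n → Bool) (k : ℕ) (h : k < t + 1) (b : WorkBasis n) :
    (workAlgorithm t U).state x k h b =
      evolveFamily U (Matrix.of fun b _ => Pi.single (M := fun _ => ℂ) default 1 b) k b x := by
  induction k generalizing b with
  | zero => rfl
  | succ k ih =>
    refine ((workAlgorithm t U).state_succ_apply x k h b).trans ?_
    rw [evolveFamily, Matrix.mul_apply]
    exact Finset.sum_congr rfl fun c _ =>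
      congrArg (fun z => U (k + 1) b c * ((literalSign x c.2.1 : ℂ) * z)) (ih _ c)

theorem QuerySolvable.exists_algorithm {f : BoolFun n} {t : ℕ}
    (h : QuerySolvable f t (Matrix.of fun _ _ => 1)) :
    ∃ A : QueryAlgorithm n t, A.ComputesExactly f := by
  obtain ⟨U, hU⟩ := h.exists_unitaries
    (Matrix.of fun b _ => Pi.single (M := fun _ => ℂ) default 1 b) (by
      ext x y
      rw [Matrix.mul_apply, Finset.sum_eq_single default (fun b _ hb => by simp [hb]) (by simp)]
      simp)
  refine ⟨workAlgorithm t U, fun x => (QueryAlgorithm.outputProb_eq_one_iff _ _ _).2 ?_⟩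
  intro b hb
  exact (workAlgorithm_state t U x t _ b).trans (hU b x hb)

end Solvable

/-! ### Adaptive query trees and their realisation. -/

section QueryTree

variable {n : ℕ}

/-- The amplitude obtained by projecting the state with amplitudes `(-1)^{x_i}` onto the vector
`c`. -/
def amplitude (c : Option (Fin n) → ℤ) (x : Fin n → Bool) : ℤ := ∑ i, c i * literalSign x i

/-- The vectors `c ∈ l`, suitably normalised, describe a measurement of the state that results from
querying a superposition of the input bits. -/
def IsMeasurement (l : List (Option (Fin n) → ℤ)) : Prop :=
  (∀ i j, i ≠ j → (l.map fun c => c i * c j).sum = 0) ∧ ∑ i, (l.map fun c => c i * c i).sum ≠ 0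

instance : DecidablePred (IsMeasurement (n := n)) := fun _ => instDecidableAnd

/-- There is a procedure that determines `f` on the inputs in `D` by `t` single queries of a
superposition, each followed by a measurement. -/
inductive QueryTree (f : BoolFun n) : ℕ → Set (Fin n → Bool) → Prop
  | leaf (t : ℕ) (D : Set (Fin n → Bool)) (v : Bool) (h : ∀ x ∈ D, f x = v) : QueryTree f t D
  | node (t : ℕ) (D : Set (Fin n → Bool)) (l : List (Option (Fin n) → ℤ)) (hl : IsMeasurement l)
      (h : ∀ c ∈ l, QueryTree f t {x | x ∈ D ∧ amplitude c x ≠ 0}) : QueryTree f (t + 1) D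

open scoped ComplexOrder in
theorem querySolvable_of_constant {f : BoolFun n} (t : ℕ)
    {G : Matrix (Fin n → Bool) (Fin n → Bool) ℂ} (hG : G.PosSemidef)
    (h : ∀ x y, f x ≠ f y → G x y = 0) : QuerySolvable f t G := by
  induction t with
  | zero => exact ⟨hG, h⟩
  | succ t ih =>
    -- Surplus queries are spent on the label `none`, where they do nothing.
    refine ⟨fun i => if i = none then G else 0, fun i => ?_, by simp, ?_⟩
    · by_cases hi : i = none
      · simpa [hi] using hG
      · simpa [hi] using Matrix.PosSemidef.zero
    · convert ih
      ext x y
      simp [Matrix.sum_apply, Fintype.sum_option, literalSign]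

/-- Being a measurement says that the sum of the matrices `c cᵀ` is diagonal, so the cross terms
cancel. -/
theorem sum_amplitude_mul_amplitude {l : List (Option (Fin n) → ℤ)} (hl : IsMeasurement l)
    (x y : Fin n → Bool) :
    (l.map fun c => amplitude c x * amplitude c y).sum =
      ∑ i, (l.map fun c => c i * c i).sum * (literalSign x i * literalSign y i) := by
  have h1 : ∀ c : Option (Fin n) → ℤ, amplitude c x * amplitude c y =
      ∑ i, ∑ j, (c i * c j) * (literalSign x i * literalSign y j) := by
    intro c
    rw [amplitude, amplitude, Finset.sum_mul_sum]
    exact Finset.sum_congr rfl fun i _ => Finset.sum_congr rfl fun j _ => by ring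
  have h2 : ∀ l : List (Option (Fin n) → ℤ), (l.map fun c => amplitude c x * amplitude c y).sum =
      ∑ i, ∑ j, (l.map fun c => c i * c j).sum * (literalSign x i * literalSign y j) := by
    intro l
    induction l with
    | nil => simp
    | cons c l ih => simp only [List.map_cons, List.sum_cons, ih, add_mul, Finset.sum_add_distrib, h1 c]
  rw [h2]
  refine Finset.sum_congr rfl fun i _ => ?_
  rw [Finset.sum_eq_single i (fun j _ hj => by rw [hl.1 i j hj.symm, zero_mul]) (by simp)]

open scoped ComplexOrder in
-- The measurement is deferred. Querying label `i` with weight `w i / W` multiplies `G` entrywise by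
-- a kernel which is also the sum, over outcomes `c`, of the products of amplitudes divided by `W`.
-- Each summand is a Gram matrix supported on the inputs surviving that outcome.
theorem QueryTree.querySolvable {f : BoolFun n} {t : ℕ} {D : Set (Fin n → Bool)}
    (hT : QueryTree f t D) {G : Matrix (Fin n → Bool) (Fin n → Bool) ℂ} (hG : G.PosSemidef)
    (hD : ∀ x y, G x y ≠ 0 → x ∈ D ∧ y ∈ D) : QuerySolvable f t G := by
  induction hT generalizing G with
  | leaf t D v h =>
    refine querySolvable_of_constant t hG fun x y hxy => ?_
    by_contra h0
    obtain ⟨hx, hy⟩ := hD x y h0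
    exact hxy ((h x hx).trans (h y hy).symm)
  | node t D l hl h ih =>
    set w : Option (Fin n) → ℤ := fun i => (l.map fun c => c i * c i).sum with hw
    set W : ℤ := ∑ i, w i with hW
    have hw0 : ∀ i, 0 ≤ w i := fun i => List.sum_nonneg fun a ha => by
      obtain ⟨c, -, rfl⟩ := List.mem_map.1 ha
      exact mul_self_nonneg _
    have hW0 : 0 < W := lt_of_le_of_ne (Finset.sum_nonneg fun i _ => hw0 i) (Ne.symm hl.2)
    have hW' : (W : ℂ) ≠ 0 := by exact_mod_cast hW0.ne'
    have hscal : ∀ a : ℤ, 0 ≤ a → (0 : ℂ) ≤ (a : ℂ) / W := fun a ha => by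
      have : (0 : ℝ) ≤ (a : ℝ) / W := div_nonneg (by exact_mod_cast ha) (by exact_mod_cast hW0.le)
      have h2 := Complex.zero_le_real.2 this
      push_cast at h2
      exact h2
    refine ⟨fun i => ((w i : ℂ) / W) • G, fun i => hG.smul (hscal _ (hw0 i)), ?_, ?_⟩
    · rw [← Finset.sum_smul, ← Finset.sum_div]
      have : (∑ i, (w i : ℂ)) = W := by rw [hW]; push_cast; rfl
      rw [this, div_self hW', one_smul]
    · let N : (Option (Fin n) → ℤ) → Matrix (Fin n → Bool) (Fin n → Bool) ℂ := fun c =>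
        ((1 : ℤ) / W : ℂ) • ((Matrix.diagonal fun x => (amplitude c x : ℂ))ᴴ * G *
          Matrix.diagonal fun x => (amplitude c x : ℂ))
      have hN : ∀ c x y, N c x y = (amplitude c x * amplitude c y / W : ℂ) * G x y := by
        intro c x y
        simp only [N, Matrix.smul_apply, Matrix.mul_diagonal, Matrix.diagonal_conjTranspose,
          Matrix.diagonal_mul, Pi.star_apply, smul_eq_mul]
        simp
        ring
      -- The sum runs over positions in `l`, since a measurement may repeat a vector.
      have key : (∑ i, Matrix.of fun x y => (literalSign x i * literalSign y i : ℂ) *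
          (((w i : ℂ) / W) • G) x y) = ∑ k : Fin l.length, N l[k] := by
        ext x y
        simp only [Matrix.sum_apply, hN, Matrix.of_apply, Matrix.smul_apply, smul_eq_mul]
        have h1 := sum_amplitude_mul_amplitude hl x y
        rw [← Fin.sum_univ_fun_getElem] at h1
        have h2 := congrArg (Int.cast (R := ℂ)) h1
        push_cast at h2
        rw [← Finset.sum_mul, ← Finset.sum_div]
        erw [h2]
        rw [Finset.sum_div, Finset.sum_mul]
        refine Finset.sum_congr rfl fun i _ => ?_
        simp only [hw]
        push_cast
        ring
      rw [key]
      refine QuerySolvable.sum _ fun k _ => ih l[k] (by simp)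
        ((hG.conjTranspose_mul_mul_same _).smul (hscal 1 zero_le_one)) fun x y hxy => ?_
      have hxy' : N l[k] x y ≠ 0 := hxy
      rw [hN] at hxy'
      have hG' := right_ne_zero_of_mul hxy'
      have ha := left_ne_zero_of_mul hxy'
      refine ⟨⟨(hD x y hG').1, fun h0 => ha ?_⟩, ⟨(hD x y hG').2, fun h0 => ha ?_⟩⟩
      · simp only [Fin.getElem_fin] at h0 ⊢
        simp [h0]
      · simp only [Fin.getElem_fin] at h0 ⊢
        simp [h0]

open scoped ComplexOrder in
theorem QueryTree.exists_algorithm {f : BoolFun n} {t : ℕ} (h : QueryTree f t Set.univ) :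
    ∃ A : QueryAlgorithm n t, A.ComputesExactly f := by
  refine (h.querySolvable (G := Matrix.of fun _ _ => 1) ?_ fun _ _ _ =>
    ⟨trivial, trivial⟩).exists_algorithm
  have := Matrix.posSemidef_vecMulVec_self_star (fun _ : Fin n → Bool => (1 : ℂ))
  convert this
  ext x y
  simp [Matrix.vecMulVec]

theorem QueryTree.mono {f : BoolFun n} {t : ℕ} {D D' : Set (Fin n → Bool)} (h : QueryTree f t D)
    (hD : D' ⊆ D) : QueryTree f t D' := by
  induction h generalizing D' with
  | leaf t D v h => exact .leaf t D' v fun x hx => h x (hD hx)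
  | node t D l hl h ih => exact .node t D' l hl fun c hc => ih c hc fun x hx => ⟨hD hx.1, hx.2⟩

/-- The measurement that reveals the parity of the bits with labels `i` and `j`. -/
def parityMeasurement (i j : Option (Fin n)) : List (Option (Fin n) → ℤ) :=
  [fun k => if k = i then 1 else if k = j then 1 else 0,
    fun k => if k = i then 1 else if k = j then -1 else 0]

theorem isMeasurement_parityMeasurement (i j : Option (Fin n)) :
    IsMeasurement (parityMeasurement i j) := by
  refine ⟨fun a b hab => ?_, ne_of_gt (Finset.sum_pos' (fun a _ => ?_) ⟨i, Finset.mem_univ _, ?_⟩)⟩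
  · simp only [parityMeasurement, List.map_cons, List.map_nil, List.sum_cons, List.sum_nil]
    split_ifs <;> simp_all
  · simp only [parityMeasurement, List.map_cons, List.map_nil, List.sum_cons, List.sum_nil]
    split_ifs <;> simp
  · simp [parityMeasurement]

/-- The two amplitudes are the sum and the difference of two signs, and exactly one of them is
nonzero. -/
theorem QueryTree.parity {f : BoolFun n} {t : ℕ} {D : Set (Fin n → Bool)} {i j : Option (Fin n)}
    (hij : i ≠ j) (h₀ : QueryTree f t {x | x ∈ D ∧ literalSign x i = literalSign x j})
    (h₁ : QueryTree f t {x | x ∈ D ∧ literalSign x i ≠ literalSign x j}) :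
    QueryTree f (t + 1) D := by
  have key : ∀ (a : ℤ) (x : Fin n → Bool),
      amplitude (fun k => if k = i then 1 else if k = j then a else 0) x =
        literalSign x i + a * literalSign x j := by
    intro a x
    have : ∀ k, (if k = i then 1 else if k = j then a else 0) * literalSign x k =
        (if k = i then literalSign x i else 0) + if k = j then a * literalSign x j else 0 := by
      intro k
      split_ifs <;> simp_all
    simp only [amplitude, this, Finset.sum_add_distrib, Finset.sum_ite_eq', Finset.mem_univ, if_true]
  refine .node t D _ (isMeasurement_parityMeasurement i j) fun c hc => ?_
  simp only [parityMeasurement, List.mem_cons, List.not_mem_nil, or_false] at hc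
  rcases hc with rfl | rfl
  · refine h₀.mono fun x hx => ⟨hx.1, ?_⟩
    have h2 := hx.2
    rw [key] at h2
    rcases literalSign_eq x i with h | h <;> rcases literalSign_eq x j with h' | h' <;> simp_all
  · refine h₁.mono fun x hx => ⟨hx.1, fun h => hx.2 ?_⟩
    rw [key, h]
    ring

/-- Extend a vector by `0` at the label of a new input bit at position `j`. -/
def extendVector (j : Fin (n + 1)) (c : Option (Fin n) → ℤ) : Option (Fin (n + 1)) → ℤ
  | none => c none
  | some i => j.insertNth (α := fun _ => ℤ) 0 (fun k => c (some k)) i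

theorem amplitude_extendVector (j : Fin (n + 1)) (c : Option (Fin n) → ℤ)
    (x : Fin (n + 1) → Bool) :
    amplitude (extendVector j c) x = amplitude c (j.removeNth x) := by
  simp only [amplitude, Fintype.sum_option, Fin.sum_univ_succAbove _ j, extendVector, literalSign,
    Fin.removeNth, Fin.insertNth_apply_same, Fin.insertNth_apply_succAbove, zero_mul, zero_add]
  rfl

theorem IsMeasurement.extendVector {l : List (Option (Fin n) → ℤ)} (hl : IsMeasurement l)
    (j : Fin (n + 1)) : IsMeasurement (l.map (extendVector j)) := by
  refine ⟨fun a b hab => ?_, ?_⟩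
  · rw [List.map_map]
    have hj : ∀ c : Option (Fin n) → ℤ, _root_.extendVector j c (some j) = 0 := fun c => by
      simp [_root_.extendVector]
    have hk : ∀ (c : Option (Fin n) → ℤ) k, _root_.extendVector j c (some (j.succAbove k)) =
        c (some k) := fun c k => by simp [_root_.extendVector]
    have hn : ∀ (c : Option (Fin n) → ℤ), _root_.extendVector j c none = c none := fun c => rfl
    have hcases : ∀ a : Option (Fin (n + 1)), a = some j ∨ ∃ a' : Option (Fin n),
        a = a'.map j.succAbove := by
      rintro (_ | a)
      · exact Or.inr ⟨none, rfl⟩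
      · rcases Fin.eq_self_or_eq_succAbove j a with rfl | ⟨k, rfl⟩
        · exact Or.inl rfl
        · exact Or.inr ⟨some k, rfl⟩
    have hm : ∀ (c : Option (Fin n) → ℤ) (a : Option (Fin n)),
        _root_.extendVector j c (a.map j.succAbove) = c a := by
      rintro c (_ | a)
      · rfl
      · exact hk c a
    rcases hcases a with rfl | ⟨a, rfl⟩
    · simp [Function.comp_def, hj]
    rcases hcases b with rfl | ⟨b, rfl⟩
    · simp [Function.comp_def, hj]
    · simp only [Function.comp_def, hm]
      exact hl.1 a b fun h => hab (by rw [h])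
  · convert hl.2 using 1
    simp [Fintype.sum_option, Fin.sum_univ_succAbove _ j, _root_.extendVector, Function.comp_def]

/-- On `D` the bit `j` carries no further information, so a tree for the remaining bits serves, with
coefficient zero at `j`. -/
theorem QueryTree.of_removeNth {f : BoolFun (n + 1)} {g : BoolFun n} (j : Fin (n + 1)) {t : ℕ}
    {D : Set (Fin (n + 1) → Bool)} {E : Set (Fin n → Bool)} (hg : QueryTree g t E)
    (hD : ∀ x ∈ D, j.removeNth x ∈ E ∧ f x = g (j.removeNth x)) : QueryTree f t D := by
  induction hg generalizing D with
  | leaf t E v h => exact .leaf t D v fun x hx => (hD x hx).2.trans (h _ (hD x hx).1)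
  | node t E l hl h ih =>
    refine .node t D _ (hl.extendVector j) fun c hc => ?_
    obtain ⟨d, hd, rfl⟩ := List.mem_map.1 hc
    refine ih d hd fun x hx => ⟨⟨(hD x hx.1).1, ?_⟩, (hD x hx.1).2⟩
    rw [← amplitude_extendVector]
    exact hx.2

/-- The value of the bit with a given label. -/
def labelBit (x : Fin n → Bool) : Option (Fin n) → Bool
  | none => false
  | some i => x i

theorem literalSign_eq_iff (x : Fin n → Bool) (i j : Option (Fin n)) :
    literalSign x i = literalSign x j ↔ labelBit x i = labelBit x j := by
  have : ∀ i, literalSign x i = if labelBit x i then -1 else 1 := by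
    rintro (_ | i) <;> rfl
  rw [this, this]
  cases labelBit x i <;> cases labelBit x j <;> simp

/-- The function of the other bits that results from fixing the parity `v` of the bit at position
`j` and the bit with label `i` among the others. -/
def restrictParity (f : BoolFun (n + 1)) (j : Fin (n + 1)) (i : Option (Fin n)) (v : Bool) :
    BoolFun n :=
  fun y => f (j.insertNth (xor v (labelBit y i)) y)

theorem queryTree_of_restrictParity {f : BoolFun (n + 1)} (j : Fin (n + 1)) (i : Option (Fin n))
    {t : ℕ} (h : ∀ v, QueryTree (restrictParity f j i v) t Set.univ) :
    QueryTree f (t + 1) Set.univ := by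
  have hbit : ∀ x, labelBit x (i.map j.succAbove) = labelBit (j.removeNth x) i := by
    intro x
    cases i <;> rfl
  have hne : some j ≠ i.map j.succAbove := by
    cases i with
    | none => simp
    | some i => simp
  have hf : ∀ x v, x j = xor v (labelBit (j.removeNth x) i) →
      f x = restrictParity f j i v (j.removeNth x) := by
    intro x v hx
    rw [restrictParity, ← hx, Fin.insertNth_self_removeNth]
  refine .parity hne ((h false).of_removeNth j fun x hx => ⟨trivial, hf x _ ?_⟩)
    ((h true).of_removeNth j fun x hx => ⟨trivial, hf x _ ?_⟩)
  · have := hx.2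
    rw [literalSign_eq_iff, hbit] at this
    rw [← this]
    simp [labelBit]
  · have := hx.2
    rw [ne_eq, literalSign_eq_iff, hbit] at this
    change ¬ x j = _ at this
    cases h1 : x j <;> cases h2 : labelBit (j.removeNth x) i <;> simp_all

/-- Comparing a bit with the label `none` reads it, so this is the trivial algorithm that reads all
bits. -/
theorem queryTree_self (f : BoolFun n) : QueryTree f n Set.univ := by
  induction n with
  | zero => exact .leaf _ _ (f default) fun x _ => congrArg f (Subsingleton.elim _ _)
  | succ n ih => exact queryTree_of_restrictParity 0 none fun v => ih _

end QueryTree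

/-! ### The polynomial method. -/

section LowerBound

variable {n : ℕ}

/-- The parity character of a set of input bits. -/
def parityCharacter (T : Finset (Fin n)) (x : Fin n → Bool) : ℤ :=
  ∏ i ∈ T, literalSign x (some i)

theorem parityCharacter_ne_zero (T : Finset (Fin n)) (x : Fin n → Bool) :
    parityCharacter T x ≠ 0 :=
  Finset.prod_ne_zero_iff.2 fun i _ => by
    rcases literalSign_eq x (some i) with h | h <;> simp [h]

theorem sum_parityCharacter_eq_zero {T : Finset (Fin n)} (hT : T.Nonempty) :
    ∑ x, parityCharacter T x = 0 := by
  obtain ⟨i, hi⟩ := hT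
  -- Flipping a bit of `T` reverses the sign of the character.
  have hinv : Function.Involutive fun x : Fin n → Bool => Function.update x i (!x i) := by
    intro x
    simp
  have h : ∑ x, parityCharacter T x = ∑ x, -parityCharacter T x := by
    refine Fintype.sum_equiv hinv.toPerm _ _ fun x => ?_
    rw [parityCharacter, parityCharacter, ← Finset.mul_prod_erase _ _ hi,
      ← Finset.mul_prod_erase _ _ hi, ← neg_mul]
    congr 1
    · cases h : x i <;> simp [literalSign, h]
    · refine Finset.prod_congr rfl fun k hk => ?_
      simp [literalSign, Finset.ne_of_mem_erase hk]
  rw [Finset.sum_neg_distrib] at h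
  linarith

/-- After `k` queries every amplitude is orthogonal to the parities of more than `k` bits. -/
theorem QueryAlgorithm.sum_parityCharacter_mul_state {t : ℕ} (A : QueryAlgorithm n t) (k : ℕ)
    (h : k < t + 1) (b : A.B) (T : Finset (Fin n)) (hT : k < T.card) :
    ∑ x, (parityCharacter T x : ℂ) * A.state x k h b = 0 := by
  induction k generalizing b T with
  | zero =>
    have h0 : ∀ x, A.state x 0 h b = ((A.unit ⟨0, h⟩ : Matrix A.B A.B ℂ) *ᵥ A.init) b :=
      fun _ => rfl
    simp only [h0]
    rw [← Finset.sum_mul, ← Int.cast_sum, sum_parityCharacter_eq_zero (Finset.card_pos.1 hT)]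
    simp
  | succ k ih =>
    simp only [A.state_succ_apply, Finset.mul_sum]
    rw [Finset.sum_comm]
    refine Finset.sum_eq_zero fun c _ => ?_
    -- The sign of a queried bit toggles its membership in `T`, so one query lowers the size by at
    -- most one.
    have key : ∃ S : Finset (Fin n), k < S.card ∧ ∀ x,
        parityCharacter T x * literalSign x (A.label c) = parityCharacter S x := by
      cases A.label c with
      | none => exact ⟨T, by omega, fun x => by simp [literalSign]⟩
      | some i =>
        by_cases hi : i ∈ T
        · refine ⟨T.erase i, by rw [Finset.card_erase_of_mem hi]; omega, fun x => ?_⟩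
          rw [parityCharacter, parityCharacter, ← Finset.mul_prod_erase _ _ hi, mul_right_comm,
            literalSign_mul_self, one_mul]
        · refine ⟨insert i T, by rw [Finset.card_insert_of_notMem hi]; omega, fun x => ?_⟩
          rw [parityCharacter, parityCharacter, Finset.prod_insert hi, mul_comm]
    obtain ⟨S, hS, hST⟩ := key
    have h1 := ih (Nat.lt_of_succ_lt h) c S hS
    calc ∑ x, (parityCharacter T x : ℂ) * ((A.unit ⟨k + 1, h⟩ : Matrix A.B A.B ℂ) b c *
          (literalSign x (A.label c) * A.state x k (Nat.lt_of_succ_lt h) c))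
        = (A.unit ⟨k + 1, h⟩ : Matrix A.B A.B ℂ) b c *
          ∑ x, (parityCharacter S x : ℂ) * A.state x k (Nat.lt_of_succ_lt h) c := by
          rw [Finset.mul_sum]
          refine Finset.sum_congr rfl fun x _ => ?_
          rw [← hST]
          push_cast
          ring
      _ = 0 := by rw [h1, mul_zero]

/-- A function that takes one of its values exactly once needs as many queries as it has bits. -/
theorem QueryAlgorithm.ComputesExactly.le_of_unique {t : ℕ} {A : QueryAlgorithm n t}
    {f : BoolFun n} (hA : A.ComputesExactly f) (p : Fin n → Bool)
    (hp : ∀ x, x ≠ p → f x ≠ f p) : n ≤ t := by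
  by_contra hlt
  have hzero : ∀ x, ∀ b, A.out b ≠ f x → A.finalState x b = 0 := fun x =>
    (A.outputProb_eq_one_iff x (f x)).1 (hA x)
  have hall : ∀ b, A.finalState p b = 0 := by
    intro b
    by_cases hb : A.out b = f p
    · have h1 := A.sum_parityCharacter_mul_state t (Nat.lt_succ_self t) b Finset.univ
        (by simpa using hlt)
      rw [Finset.sum_eq_single p _ (by simp)] at h1
      · exact (mul_eq_zero.1 h1).resolve_left (by exact_mod_cast parityCharacter_ne_zero _ _)
      · intro x _ hx
        have : A.finalState x b = 0 := hzero x b (by rw [hb]; exact (hp x hx).symm)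
        exact mul_eq_zero_of_right _ this
    · exact hzero p b hb
  have h1 := A.sum_norm_sq_state p t (Nat.lt_succ_self t)
  have h2 : ∀ b, A.state p t (Nat.lt_succ_self t) b = 0 := hall
  simp [h2] at h1

theorem QueryIsomorphic.exists_unique_value {f : BoolFun n} (h : QueryIsomorphic f (andFun n)) :
    ∃ p, ∀ x, x ≠ p → f x ≠ f p := by
  obtain ⟨σ, a, c, h⟩ := h
  let p : Fin n → Bool := fun i => !a (σ.symm i)
  have hand : ∀ x, andFun n (fun i => xor (a i) (x (σ i))) = true ↔ x = p := by
    intro x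
    simp only [andFun, decide_eq_true_eq]
    constructor
    · intro hx
      funext i
      have := hx (σ.symm i)
      rw [Equiv.apply_symm_apply] at this
      cases h1 : a (σ.symm i) <;> cases h2 : x i <;> simp_all [p]
    · rintro rfl i
      simp [p]
  refine ⟨p, fun x hx hfx => hx ((hand x).1 ?_)⟩
  rw [h, h, (hand p).2 rfl] at hfx
  cases c <;> simpa using hfx

end LowerBound

/-! ### Three bits: two queries suffice without a unique value. -/

section ThreeBits

/-- The input whose bits are the binary digits of `k`. -/
def binaryInput (n k : ℕ) : Fin n → Bool := fun i => k.testBit i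

/-- The linear form with the given coefficients. -/
def vector₄ (a b c d : ℤ) : Option (Fin 3) → ℤ
  | none => a
  | some 0 => b
  | some 1 => c
  | some 2 => d

/-- A measurement suited to distinguishing the inputs that differ from a given one in exactly one
bit. -/
def weightMeasurement (b c d : ℤ) : List (Option (Fin 3) → ℤ) :=
  [vector₄ 1 b c d, vector₄ 1 (-b) 0 0, vector₄ 1 0 (-c) 0, vector₄ 1 0 0 (-d),
    vector₄ 0 b (-c) 0, vector₄ 0 b 0 (-d), vector₄ 0 0 c (-d)]

/-- The sum of two multiples of coordinate vectors. -/
def pairVector (i j : Option (Fin 3)) (a b : ℤ) : Option (Fin 3) → ℤ :=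
  fun k => (if k = i then a else 0) + if k = j then b else 0

/-- A measurement adapted to splitting the labels into the pairs `i, j` and `k, l`. -/
def matchingMeasurement (i j k l : Option (Fin 3)) (a b : ℤ) : List (Option (Fin 3) → ℤ) :=
  [pairVector i j 1 a, pairVector i j 1 a, pairVector k l 1 b, pairVector k l 1 b,
    pairVector i j 1 (-a) + pairVector k l 1 (-b), pairVector i j 1 (-a) - pairVector k l 1 (-b)]

/-- Measurements for the first of two queries to three bits. -/
def firstMeasurements : List (List (Option (Fin 3) → ℤ)) :=
  [parityMeasurement none (some 0), parityMeasurement none (some 1),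
    parityMeasurement none (some 2), parityMeasurement (some 0) (some 1),
    parityMeasurement (some 0) (some 2), parityMeasurement (some 1) (some 2)] ++
  ([1, -1].flatMap fun a => [1, -1].flatMap fun b =>
    [matchingMeasurement none (some 0) (some 1) (some 2) a b,
      matchingMeasurement none (some 1) (some 0) (some 2) a b,
      matchingMeasurement none (some 2) (some 0) (some 1) a b]) ++
  ([1, -1].flatMap fun a => [1, -1].flatMap fun b => [1, -1].map fun c => weightMeasurement a b c)

theorem isMeasurement_of_mem_firstMeasurements :
    ∀ l ∈ firstMeasurements, IsMeasurement l := by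
  decide +kernel

/-- The set of inputs on which the amplitude `c` does not vanish, as a bit mask. -/
def supportMask (c : Option (Fin 3) → ℤ) : ℕ :=
  Nat.ofBits fun k : Fin 8 => decide (amplitude c (binaryInput 3 k) ≠ 0)

/-- The sets of inputs consistent with the outcomes of the measurements in `firstMeasurements`. -/
def firstMasks : List (List ℕ) :=
  [[85, 170], [51, 204], [15, 240], [153, 102], [165, 90], [195, 60],
    [85, 85, 195, 195, 182, 158], [51, 51, 165, 165, 214, 158], [15, 15, 153, 153, 214, 182],
    [85, 85, 60, 60, 107, 233], [51, 51, 90, 90, 109, 233], [15, 15, 102, 102, 121, 233],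
    [170, 170, 195, 195, 121, 109], [204, 204, 165, 165, 121, 107], [240, 240, 153, 153, 109, 107],
    [170, 170, 60, 60, 151, 214], [204, 204, 90, 90, 151, 182], [240, 240, 102, 102, 151, 158],
    [151, 170, 204, 240, 102, 90, 60], [121, 170, 204, 15, 102, 165, 195],
    [109, 170, 51, 240, 153, 90, 195], [214, 170, 51, 15, 153, 165, 60],
    [107, 85, 204, 240, 153, 165, 60], [182, 85, 204, 15, 153, 90, 195],
    [158, 85, 51, 240, 102, 165, 195], [233, 85, 51, 15, 102, 90, 60]]

theorem map_supportMask_firstMeasurements :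
    (firstMeasurements.map fun l => l.map supportMask) = firstMasks := by
  decide +kernel

/-- The function with truth table `m` is constant on the set of inputs `E`. -/
def constantOnMask (m E : ℕ) : Bool := Nat.beq (m &&& E) 0 || Nat.beq (m &&& E) E

/-- The two sets of inputs distinguished by the parity of the bits with two labels. -/
def parityMasks : List (ℕ × ℕ) :=
  [(85, 170), (51, 204), (15, 240), (153, 102), (165, 90), (195, 60)]

theorem pair_mem_firstMasks : ∀ P ∈ parityMasks, [P.1, P.2] ∈ firstMasks := by
  decide +kernel

/-- The function with truth table `m` is determined on the set of inputs `E` by the parity of the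
bits with two of the labels. -/
def parityOnMask (m E : ℕ) : Bool :=
  parityMasks.any fun P =>
    constantOnMask m (E &&& P.1) && constantOnMask m (E &&& P.2)

/-- The truth table `m` with `N` entries or its complement has exactly one entry. -/
def singletonTable (N m : ℕ) : Bool :=
  (List.range N).any fun k => Nat.beq m (2 ^ k) || Nat.beq (m ^^^ (2 ^ N - 1)) (2 ^ k)

/-- The finite core for three bits: after a suitable first measurement, every outcome leaves inputs
on which one parity query, chosen according to the outcome, determines the value. -/
theorem exists_firstMasks_all_parityOnMask :
    ((List.range 256).all fun m =>
      singletonTable 8 m || firstMasks.any fun l => l.all (parityOnMask m)) = true := by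
  decide +kernel

/-- The set of the inputs in a bit mask. -/
def maskSet (E : ℕ) : Set (Fin 3 → Bool) := {x | E.testBit (Nat.ofBits x) = true}

/-- The truth table of a function as a bit mask. -/
def truthTable {n : ℕ} (f : BoolFun n) : ℕ := Nat.ofBits fun k : Fin (2 ^ n) => f (binaryInput n k)

theorem binaryInput_ofBits {n : ℕ} (x : Fin n → Bool) : binaryInput n (Nat.ofBits x) = x := by
  funext i
  simp [binaryInput]

theorem testBit_truthTable {n : ℕ} (f : BoolFun n) (x : Fin n → Bool) :
    (truthTable f).testBit (Nat.ofBits x) = f x := by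
  rw [truthTable, Nat.testBit_ofBits_lt _ _ (Nat.ofBits_lt_two_pow x), binaryInput_ofBits]

theorem truthTable_lt {n : ℕ} (f : BoolFun n) : truthTable f < 2 ^ 2 ^ n :=
  Nat.ofBits_lt_two_pow _

theorem exists_constant_of_constantOnMask {f : BoolFun 3} {E : ℕ}
    (h : constantOnMask (truthTable f) E = true) : ∃ v, ∀ x ∈ maskSet E, f x = v := by
  rw [constantOnMask, Bool.or_eq_true, Nat.beq_eq, Nat.beq_eq] at h
  have hx : ∀ x, (truthTable f &&& E).testBit (Nat.ofBits x) = (f x && E.testBit (Nat.ofBits x)) :=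
    fun x => by rw [Nat.testBit_and, testBit_truthTable]
  rcases h with h | h
  · refine ⟨false, fun x hE => ?_⟩
    have h1 := hx x
    rw [h, Nat.zero_testBit, (hE : E.testBit _ = true), Bool.and_true] at h1
    exact h1.symm
  · refine ⟨true, fun x hE => ?_⟩
    have h1 := hx x
    rw [h, (hE : E.testBit _ = true), Bool.and_true] at h1
    exact h1.symm

theorem maskSet_supportMask (c : Option (Fin 3) → ℤ) :
    maskSet (supportMask c) = {x | amplitude c x ≠ 0} := by
  ext x
  rw [maskSet, Set.mem_ofPred_eq, supportMask,
    Nat.testBit_ofBits_lt _ _ (Nat.ofBits_lt_two_pow x), Fin.val_mk, binaryInput_ofBits]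
  simp

theorem maskSet_and (E F : ℕ) : maskSet (E &&& F) = maskSet E ∩ maskSet F := by
  ext x
  simp [maskSet]

theorem queryTree_one_of_masks {f : BoolFun 3} {E : ℕ} (l : List (Option (Fin 3) → ℤ))
    (hl : IsMeasurement l)
    (h : ∀ F ∈ l.map supportMask, constantOnMask (truthTable f) (E &&& F) = true) :
    QueryTree f 1 (maskSet E) := by
  refine .node 0 _ l hl fun c hc => ?_
  obtain ⟨v, hv⟩ := exists_constant_of_constantOnMask (h _ (List.mem_map_of_mem hc))
  rw [maskSet_and, maskSet_supportMask] at hv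
  exact .leaf 0 _ v hv

theorem queryTree_one_of_parityOnMask {f : BoolFun 3} {E : ℕ}
    (h : parityOnMask (truthTable f) E = true) : QueryTree f 1 (maskSet E) := by
  obtain ⟨P, hP, h⟩ := List.any_eq_true.1 h
  rw [Bool.and_eq_true] at h
  have key : [P.1, P.2] ∈ firstMasks := pair_mem_firstMasks P hP
  rw [← map_supportMask_firstMeasurements] at key
  obtain ⟨l, hl, hlP⟩ := List.mem_map.1 key
  refine queryTree_one_of_masks l (isMeasurement_of_mem_firstMeasurements l hl) ?_
  rw [hlP]
  simp [h.1, h.2]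

theorem queryTree_two_of_not_singletonTable {f : BoolFun 3}
    (h : singletonTable (2 ^ 3) (truthTable f) = false) : QueryTree f 2 Set.univ := by
  have h1 := List.all_eq_true.1 exists_firstMasks_all_parityOnMask (truthTable f)
    (List.mem_range.2 (truthTable_lt f))
  rw [show singletonTable 8 (truthTable f) = false from h, Bool.false_or] at h1
  obtain ⟨L, hL, h2⟩ := List.any_eq_true.1 h1
  rw [← map_supportMask_firstMeasurements] at hL
  obtain ⟨l, hl, rfl⟩ := List.mem_map.1 hL
  refine .node 1 _ l (isMeasurement_of_mem_firstMeasurements l hl) fun c hc => ?_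
  have h3 := queryTree_one_of_parityOnMask
    (List.all_eq_true.1 h2 _ (List.mem_map_of_mem hc))
  rw [maskSet_supportMask] at h3
  exact h3.mono fun x hx => hx.2

end ThreeBits

/-! ### Unique values, truth tables and isomorphism with AND. -/

section UniqueValue

variable {n : ℕ}

/-- The function takes one of its values exactly once. -/
def HasUniqueValue (f : BoolFun n) : Prop := ∃ p, ∀ x, x ≠ p → f x ≠ f p

theorem ofBits_binaryInput {k : ℕ} (hk : k < 2 ^ n) : Nat.ofBits (binaryInput n k) = k := by
  rw [show binaryInput n k = fun i : Fin n => k.testBit i from rfl, Nat.ofBits_testBit,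
    Nat.mod_eq_of_lt hk]

theorem hasUniqueValue_of_testBit {f : BoolFun n} {k : ℕ} (hk : k < 2 ^ n) (c : Bool)
    (h : ∀ x, xor c (f x) = (2 ^ k).testBit (Nat.ofBits x)) : HasUniqueValue f := by
  refine ⟨binaryInput n k, fun x hx hfx => hx ?_⟩
  have h1 : xor c (f x) = true := by
    rw [hfx, h, ofBits_binaryInput hk, Nat.testBit_two_pow_self]
  rw [h, Nat.testBit_two_pow, decide_eq_true_eq] at h1
  rw [h1, binaryInput_ofBits]

theorem hasUniqueValue_of_singletonTable {f : BoolFun n}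
    (h : singletonTable (2 ^ n) (truthTable f) = true) : HasUniqueValue f := by
  obtain ⟨k, hk, h⟩ := List.any_eq_true.1 h
  rw [Bool.or_eq_true, Nat.beq_eq, Nat.beq_eq] at h
  rw [List.mem_range] at hk
  rcases h with h | h
  · refine hasUniqueValue_of_testBit hk false fun x => ?_
    rw [← h, testBit_truthTable, Bool.false_xor]
  · refine hasUniqueValue_of_testBit hk true fun x => ?_
    rw [← h, Nat.testBit_xor, testBit_truthTable, Nat.testBit_two_pow_sub_one,
      decide_eq_true (Nat.ofBits_lt_two_pow x), Bool.xor_comm]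

theorem HasUniqueValue.queryIsomorphic {f : BoolFun n} (h : HasUniqueValue f) :
    QueryIsomorphic f (andFun n) := by
  obtain ⟨p, hp⟩ := h
  refine ⟨1, fun i => !p i, !f p, fun x => ?_⟩
  by_cases hx : x = p
  · subst hx
    simp [andFun]
  · have h1 : andFun n (fun i => xor (!p i) (x ((1 : Equiv.Perm (Fin n)) i))) = false := by
      rw [andFun, decide_eq_false_iff_not]
      refine fun h => hx (funext fun i => ?_)
      have := h i
      cases h1 : p i <;> cases h2 : x i <;> simp_all
    rw [h1]
    have := hp x hx
    cases h1 : f x <;> cases h2 : f p <;> simp_all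

end UniqueValue

/-! ### Four bits: a first query reducing to three bits. -/

section FourBits

/-- The number has exactly one binary digit `1`. -/
def isPowerOfTwoMask (m : ℕ) : Bool := !Nat.beq m 0 && Nat.beq (m &&& (m - 1)) 0

/-- The function with truth table `m` takes one of its values exactly once on the set `H`. -/
def singletonOnMask (m H : ℕ) : Bool :=
  isPowerOfTwoMask (m &&& H) || isPowerOfTwoMask ((m &&& H) ^^^ H)

/-- Labels of two input bits, with the sets of inputs on which these bits agree and differ. -/
def splittings : List ((Fin 4 × Option (Fin 3)) × (ℕ × ℕ)) :=
  [((3, none), (255, 65280)), ((2, none), (3855, 61680)), ((1, none), (13107, 52428)),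
    ((0, none), (21845, 43690)), ((3, some 2), (61455, 4080)), ((3, some 1), (52275, 13260)),
    ((3, some 0), (43605, 21930)), ((2, some 1), (50115, 15420)), ((2, some 0), (42405, 23130)),
    ((1, some 0), (39321, 26214))]

theorem testBit_splittings :
    ∀ s ∈ splittings, ∀ x : Fin 4 → Bool,
      s.2.1.testBit (Nat.ofBits x) = !xor (x s.1.1) (labelBit (s.1.1.removeNth x) s.1.2) ∧
      s.2.2.testBit (Nat.ofBits x) = xor (x s.1.1) (labelBit (s.1.1.removeNth x) s.1.2) := by
  decide +kernel

/-- One of the splittings avoids the hard case on both sides, or the truth table is itself hard. -/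
def splittable (m : ℕ) : Bool :=
  (splittings.any fun s => !singletonOnMask m s.2.1 && !singletonOnMask m s.2.2) ||
    singletonTable 16 m

/-- The truth tables of the functions of three bits that take one of their values exactly once. -/
def singletonTables : List ℕ :=
  [1, 2, 4, 8, 16, 32, 64, 128, 254, 253, 251, 247, 239, 223, 191, 127]

theorem splittable_of_low :
    (singletonTables.all fun a => (List.range 256).all fun b => splittable (a + 256 * b)) = true := by
  decide +kernel

theorem splittable_of_high :
    (singletonTables.all fun b => (List.range 256).all fun a => splittable (a + 256 * b)) = true := by
  decide +kernel

theorem singletonOnMask_of_not_mem :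
    ∀ a < 256, a ∉ singletonTables →
      singletonOnMask a 255 = false ∧ singletonOnMask (a <<< 8) 65280 = false := by
  decide +kernel

/-- Splitting on the last bit cuts the table into its low and high bytes and works unless one byte
has a unique value. Only tables with such a byte need the other splittings, which reduces the
enumeration from 65536 tables to two families of 16 · 256. -/
theorem splittable_of_lt {m : ℕ} (hm : m < 65536) : splittable m = true := by
  have ha : m % 256 < 256 := Nat.mod_lt _ (by norm_num)
  have hb : m / 256 < 256 := by omega
  by_cases h₁ : m % 256 ∈ singletonTables
  · have := List.all_eq_true.1 (List.all_eq_true.1 splittable_of_low _ h₁) _ (List.mem_range.2 hb)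
    rwa [Nat.mod_add_div] at this
  by_cases h₂ : m / 256 ∈ singletonTables
  · have := List.all_eq_true.1 (List.all_eq_true.1 splittable_of_high _ h₂) _ (List.mem_range.2 ha)
    rwa [Nat.mod_add_div] at this
  have hlow : m % 256 &&& 255 = m &&& 255 := by
    rw [Nat.and_two_pow_sub_one_eq_mod _ 8, Nat.and_two_pow_sub_one_eq_mod _ 8, Nat.mod_mod]
  have hhigh : (m / 256) <<< 8 &&& 65280 = m &&& 65280 := by
    rw [show m / 256 = m >>> 8 by rw [Nat.shiftRight_eq_div_pow], show 65280 = 255 <<< 8 from rfl]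
    refine Nat.eq_of_testBit_eq fun k => ?_
    simp only [Nat.testBit_and, Nat.testBit_shiftLeft, Nat.testBit_shiftRight]
    by_cases hk : 8 ≤ k <;> simp [hk]
  have h₃ : singletonOnMask m 255 = false := by
    have := (singletonOnMask_of_not_mem _ ha h₁).1
    rwa [singletonOnMask, hlow] at this
  have h₄ : singletonOnMask m 65280 = false := by
    have := (singletonOnMask_of_not_mem _ hb h₂).2
    rwa [singletonOnMask, hhigh] at this
  -- The first entry of `splittings` is the one on the last bit.
  rw [splittable, splittings, List.any_cons, h₃, h₄]
  rfl

theorem isPowerOfTwoMask_two_pow : ∀ k < 16, isPowerOfTwoMask (2 ^ k) = true := by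
  decide +kernel

/-- The inputs in `H` correspond bijectively to those of the restricted function by dropping bit
`j`, so a unique value there shows up as a single bit of the table, or of its complement, within
`H`. -/
theorem HasUniqueValue.singletonOnMask {f : BoolFun 4} {j : Fin 4} {i : Option (Fin 3)} {v : Bool}
    (h : HasUniqueValue (restrictParity f j i v)) {H : ℕ} (hH16 : H < 2 ^ 16)
    (hH : ∀ x : Fin 4 → Bool, H.testBit (Nat.ofBits x) =
      !xor v (xor (x j) (labelBit (j.removeNth x) i))) :
    singletonOnMask (truthTable f) H = true := by
  obtain ⟨p, hp⟩ := h
  set q : Fin 4 → Bool := j.insertNth (xor v (labelBit p i)) p with hq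
  have hqH : H.testBit (Nat.ofBits q) = true := by
    rw [hH, hq]
    simp
  have hfq : ∀ x, x ≠ q → H.testBit (Nat.ofBits x) = true → f x ≠ f q := by
    intro x hx hxH
    have hxj : x j = xor v (labelBit (j.removeNth x) i) := by
      rw [hH] at hxH
      revert hxH
      cases x j <;> cases v <;> cases labelBit (j.removeNth x) i <;> simp
    have hx' : x = j.insertNth (xor v (labelBit (j.removeNth x) i)) (j.removeNth x) := by
      rw [← hxj, Fin.insertNth_self_removeNth]
    have h1 := hp (j.removeNth x) fun h => hx (by rw [hx', h])
    rw [restrictParity, restrictParity, ← hx', ← hq] at h1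
    exact h1
  have hk : Nat.ofBits q < 16 := Nat.ofBits_lt_two_pow q
  have hbit : ∀ m < 2 ^ 16, (∀ x : Fin 4 → Bool, m.testBit (Nat.ofBits x) = decide (x = q)) →
      m = 2 ^ Nat.ofBits q := by
    intro m hm h
    refine Nat.eq_of_testBit_eq fun k => ?_
    rcases lt_or_ge k 16 with hk' | hk'
    · have h1 := h (binaryInput 4 k)
      rw [ofBits_binaryInput hk'] at h1
      rw [h1, Nat.testBit_two_pow]
      refine decide_eq_decide.2 ⟨fun h => ?_, fun h => ?_⟩
      · rw [← h, ofBits_binaryInput hk']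
      · rw [← h, binaryInput_ofBits]
    · rw [Nat.testBit_lt_two_pow (hm.trans_le (Nat.pow_le_pow_right two_pos hk')),
        Nat.testBit_two_pow_of_ne (by omega)]
  rw [_root_.singletonOnMask, Bool.or_eq_true]
  cases hv : f q with
  | true =>
    left
    rw [hbit _ (Nat.and_lt_two_pow _ hH16) fun x => ?_]
    · exact isPowerOfTwoMask_two_pow _ hk
    · rw [Nat.testBit_and, testBit_truthTable]
      by_cases hx : x = q
      · simp [hx, hv, hqH]
      · have := hfq x hx
        cases h1 : H.testBit (Nat.ofBits x) <;> simp_all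
  | false =>
    right
    rw [hbit _ (Nat.xor_lt_two_pow (Nat.and_lt_two_pow _ hH16) hH16) fun x => ?_]
    · exact isPowerOfTwoMask_two_pow _ hk
    · rw [Nat.testBit_xor, Nat.testBit_and, testBit_truthTable]
      by_cases hx : x = q
      · simp [hx, hv, hqH]
      · have := hfq x hx
        cases h1 : H.testBit (Nat.ofBits x) <;> simp_all

theorem splittings_lt : ∀ s ∈ splittings, s.2.1 < 2 ^ 16 ∧ s.2.2 < 2 ^ 16 := by
  decide +kernel

theorem queryTree_three_of_not_hasUniqueValue {f : BoolFun 4} (hf : ¬HasUniqueValue f) :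
    QueryTree f 3 Set.univ := by
  have h1 := splittable_of_lt (truthTable_lt f)
  rw [splittable, Bool.or_eq_true] at h1
  have h2 := h1.resolve_right fun h => hf (hasUniqueValue_of_singletonTable h)
  obtain ⟨s, hs, h3⟩ := List.any_eq_true.1 h2
  rw [Bool.and_eq_true, Bool.not_eq_true', Bool.not_eq_true'] at h3
  have hbits := testBit_splittings s hs
  have hlt := splittings_lt s hs
  refine queryTree_of_restrictParity s.1.1 s.1.2 fun v => queryTree_two_of_not_singletonTable ?_
  rw [← Bool.not_eq_true]
  intro h
  have hu := hasUniqueValue_of_singletonTable h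
  cases v with
  | false =>
    have := hu.singletonOnMask hlt.1 fun x => by rw [(hbits x).1, Bool.false_xor]
    rw [h3.1] at this
    exact Bool.false_ne_true this
  | true =>
    have := hu.singletonOnMask hlt.2 fun x => by rw [(hbits x).2, Bool.true_xor, Bool.not_not]
    rw [h3.2] at this
    exact Bool.false_ne_true this

end FourBits

theorem exactQuantumQueryComplexity_le {n t : ℕ} {f : BoolFun n}
    (h : QueryTree f t Set.univ) : exactQuantumQueryComplexity f ≤ t :=
  iInf₂_le t h.exists_algorithm

theorem theorem6 (f : BoolFun 4) :
    exactQuantumQueryComplexity f = 4 ↔ QueryIsomorphic f (andFun 4) := by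
  constructor
  · intro h
    by_contra hiso
    have h3 := exactQuantumQueryComplexity_le
      (queryTree_three_of_not_hasUniqueValue fun hf => hiso hf.queryIsomorphic)
    rw [h] at h3
    exact absurd h3 (by decide)
  · intro h
    obtain ⟨p, hp⟩ := h.exists_unique_value
    refine le_antisymm (exactQuantumQueryComplexity_le (queryTree_self f)) ?_
    refine le_iInf₂ fun t ht => ?_
    obtain ⟨A, hA⟩ := ht
    exact_mod_cast hA.le_of_unique p hp
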